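/- Let $N\ge 2$, let $a_0,\dots,a_N,b_1,\dots,b_N\in\mathbb{R}$ with $a_N\neq 0$ or $b_N\neq 0$, and let $$p(\theta)=a_0+\sum_{k=1}^{N}\bigl(a_k\cos k\theta+b_k\sin k\theta\bigr).$$ Let $\mathcal C\subset\mathbb{R}^2$ be the image of $[-\pi,\pi]$ under $$\gamma(\theta)=\bigl(p(\theta)\cos\theta-p'(\theta)\sin\theta,\; p(\theta)\sin\theta+p'(\theta)\cos\theta\bigr).$$ A defining polynomial of $\mathcal C$ is an irreducible $f\in\mathbb{R}[x,y]$ that generates the ideal of all polynomials in $\mathbb{R}[x,y]$ vanishing on $\mathcal C$ (so it is unique up to a nonzero constant factor). (i) If $a_0\neq 0$, or if there is $k\ge 1$ with $2k\le N$ such that $a_{2k}\neq0$ or $b_{2k}\neq 0$, then $\mathcal C$ has a defining polynomial, and every defining polynomial of $\mathcal C$ has total degree $2N+2$. (ii) If $a_0=0$ and $a_{2k}=b_{2k}=0$ for all $k\ge 1$ with $2k\le N$, then $\gamma$ traces $\mathcal C$ twice, that is, for all but finitely many $\theta\in(-\pi,\pi]$ there are exactly two $s\in(-\pi,\pi]$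 with $\gamma(s)=\gamma(\theta)$; moreover $\mathcal C$ has a defining polynomial, and every defining polynomial of $\mathcal C$ has total degree $N+1$. -/

import Mathlib

noncomputable section

/-- The trigonometric polynomial
`p(θ) = a₀ + ∑_{1 ≤ k ≤ N} (a_k cos kθ + b_k sin kθ)`; only `a 0, …, a N` and `b 1, …, b N`
are used. -/
def trigPoly (N : ℕ) (a b : ℕ → ℝ) (θ : ℝ) : ℝ :=
  a 0 + ∑ k ∈ Finset.Icc 1 N, (a k * Real.cos (k * θ) + b k * Real.sin (k * θ))

/-- The parametrization `θ ↦ (p cos θ - p' sin θ, p sin θ + p' cos θ)`. -/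
def supportParam (p : ℝ → ℝ) (θ : ℝ) : Fin 2 → ℝ :=
  ![p θ * Real.cos θ - deriv p θ * Real.sin θ, p θ * Real.sin θ + deriv p θ * Real.cos θ]

/-- The plane curve traced by `supportParam p` for `θ ∈ [-π, π]`. -/
def supportCurve (p : ℝ → ℝ) : Set (Fin 2 → ℝ) :=
  supportParam p '' Set.Icc (-Real.pi) Real.pi

/-- `f ∈ ℝ[x, y]` is a defining polynomial of the plane set `C`: it is irreducible and generates
the ideal of all polynomials vanishing on `C`. -/
def IsDefiningPolynomial (C : Set (Fin 2 → ℝ)) (f : MvPolynomial (Fin 2) ℝ) : Prop :=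
  Irreducible f ∧ MvPolynomial.vanishingIdeal ℝ C = Ideal.span {f}

/-- The `2π`-periodic parametrization `γ` traces its image `q` times: for all but finitely many
parameters `θ` in a period, exactly `q` parameters in that period have the same image as `θ`.
(To be used with `q ≥ 1`, where `ncard = q` forces finiteness.) -/
def TracesTimes (γ : ℝ → Fin 2 → ℝ) (q : ℕ) : Prop :=
  {θ ∈ Set.Ioc (-Real.pi) Real.pi |
    {s ∈ Set.Ioc (-Real.pi) Real.pi | γ s = γ θ}.ncard ≠ q}.Finite

end

/-! With t = exp(iθ), both coordinates of `supportParam` are restrictions to the unit circle of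
Laurent polynomials x(t), y(t) with exponents in [-(N+1), N+1]. Since x + iy = t(p + ip'), the
extreme coefficients of x are nonzero multiples of those of p; the factor 1 - N is where N ≥ 2
enters. The circle is infinite, so a polynomial vanishes on the curve iff its pullback vanishes for
all t ≠ 0. The vanishing ideal is therefore prime, and a dimension count makes it principal.

The degree is squeezed between two bounds. Above: multiplication by y acts on 2n consecutive powers
of t by a matrix that is affine in x, and a determinant of degree at most 2n gives a relation
(`exists_relation_totalDegree_le`). Below: a generic vertical line meets the curve in 2n distinct
points when the parametrization is generically injective (`two_mul_le_totalDegree`).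

Injectivity comes from the tangent direction. Since γ' = (p + p'')(-sin θ, cos θ), the gradient of a
defining polynomial is normal to this direction and determines t² at all but finitely many
parameters (`exists_finite_sq_eq`). What remains is whether t and -t give the same point. This holds
for infinitely many t only if all even frequencies vanish. If some even frequency survives, n = N +
1 in the parameter t; otherwise x and y are Laurent polynomials in t², and n = (N+1)/2. -/

section

open Polynomial

/-! ### Laurent polynomials as functions, and their zeros -/

/-- The functions on `ℂ` that agree with a Laurent polynomial away from `0`. -/
def laurentFun : Subalgebra ℂ (ℂ → ℂ) where
  carrier := {g | ∃ (n : ℕ) (q : ℂ[X]), ∀ t ≠ 0, t ^ n * g t = q.eval t}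
  mul_mem' := by
    rintro g h ⟨n, q, hq⟩ ⟨m, r, hr⟩
    refine ⟨n + m, q * r, fun t ht => ?_⟩
    rw [eval_mul, ← hq t ht, ← hr t ht, Pi.mul_apply]
    ring
  add_mem' := by
    rintro g h ⟨n, q, hq⟩ ⟨m, r, hr⟩
    refine ⟨n + m, X ^ m * q + X ^ n * r, fun t ht => ?_⟩
    simp only [eval_add, eval_mul, eval_pow, eval_X, ← hq t ht, ← hr t ht, Pi.add_apply]
    ring
  algebraMap_mem' := fun z => ⟨0, C z, fun t _ => by simp⟩

namespace laurentFun

theorem congr_mem {g h : ℂ → ℂ} (hg : g ∈ laurentFun) (hgh : ∀ t ≠ 0, h t = g t) :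
    h ∈ laurentFun := by
  obtain ⟨n, q, hq⟩ := hg
  exact ⟨n, q, fun t ht => by rw [hgh t ht, hq t ht]⟩

theorem zpow_mem (k : ℤ) : (fun t : ℂ => t ^ k) ∈ laurentFun := by
  refine ⟨k.natAbs, X ^ (k.natAbs + k).toNat, fun t ht => ?_⟩
  rw [eval_pow, eval_X, ← zpow_natCast, ← zpow_natCast, ← zpow_add₀ ht]
  congr 1
  omega

theorem const_mul_mem (z : ℂ) {g : ℂ → ℂ} (hg : g ∈ laurentFun) :
    (fun t => z * g t) ∈ laurentFun :=
  laurentFun.smul_mem hg z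

theorem sum_zpow_mem (s : Finset ℤ) (c : ℤ → ℂ) (d : ℤ → ℤ) :
    (fun t : ℂ => ∑ k ∈ s, c k * t ^ d k) ∈ laurentFun := by
  have h := laurentFun.sum_mem (t := s) (f := fun k t => c k * t ^ d k)
    fun k _ => const_mul_mem (c k) (zpow_mem (d k))
  convert h using 1
  ext t
  simp

/-- A Laurent polynomial that is not identically zero has finitely many zeros. -/
theorem finite_zeros {g : ℂ → ℂ} (hg : g ∈ laurentFun) {t₀ : ℂ} (h₀ : t₀ ≠ 0) (hgt : g t₀ ≠ 0) :
    {t | t ≠ 0 ∧ g t = 0}.Finite := by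
  obtain ⟨n, q, hq⟩ := hg
  have hq0 : q ≠ 0 := by
    rintro rfl
    have := hq t₀ h₀
    simp [h₀, hgt] at this
  refine (q.roots.toFinset.finite_toSet).subset fun t ht => ?_
  have := hq t ht.1
  rw [ht.2, mul_zero] at this
  simp [hq0, this.symm]

/-- A Laurent polynomial with infinitely many zeros vanishes. -/
theorem eq_zero_of_infinite {g : ℂ → ℂ} (hg : g ∈ laurentFun) {S : Set ℂ} (hS : S.Infinite)
    (h0 : ∀ t ∈ S, t ≠ 0 → g t = 0) : ∀ t ≠ 0, g t = 0 := by
  intro t ht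
  by_contra hne
  refine hS (((finite_zeros hg ht hne).union (Set.finite_singleton 0)).subset fun s hs => ?_)
  by_cases hs0 : s = 0
  · exact Or.inr hs0
  · exact Or.inl ⟨hs0, h0 s hs hs0⟩

theorem eval_mem {x y : ℂ → ℂ} (hx : x ∈ laurentFun) (hy : y ∈ laurentFun)
    (f : MvPolynomial (Fin 2) ℂ) :
    (fun t => MvPolynomial.eval ![x t, y t] f) ∈ laurentFun := by
  induction f using MvPolynomial.induction_on with
  | C a => exact congr_mem (laurentFun.algebraMap_mem a) fun t _ => by simp
  | add p q hp hq => exact congr_mem (laurentFun.add_mem hp hq) fun t _ => by simp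
  | mul_X p i hp =>
    have h2 : (fun t => (![x t, y t] : Fin 2 → ℂ) i) ∈ laurentFun := by
      fin_cases i
      · exact hx
      · exact hy
    exact congr_mem (laurentFun.mul_mem hp h2) fun t _ => by simp

end laurentFun

end

/-! ### The unit circle as a set of parameters -/

theorem injOn_exp_mul_I :
    Set.InjOn (fun θ : ℝ => Complex.exp (θ * Complex.I)) (Set.Ioc (-Real.pi) Real.pi) := by
  intro θ hθ φ hφ h
  have := Complex.exp_inj_of_neg_pi_lt_of_le_pi (x := θ * Complex.I) (y := φ * Complex.I)
    (by simpa using hθ.1) (by simpa using hθ.2) (by simpa using hφ.1) (by simpa using hφ.2) h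
  simpa using this

theorem infinite_range_exp_mul_I :
    (Set.range fun θ : ℝ => Complex.exp (θ * Complex.I)).Infinite :=
  ((Set.Ioc_infinite (by linarith [Real.pi_pos])).image injOn_exp_mul_I).mono
    (Set.image_subset_range _ _)

/-! ### Upper bound for the degree: a determinantal relation -/

/-- The Laurent polynomial with coefficients `c k`, `-n ≤ k ≤ n`, evaluated at `t`. -/
noncomputable def laurentSum (n : ℕ) (c : ℤ → ℂ) (t : ℂ) : ℂ :=
  ∑ k ∈ Finset.Icc (-n : ℤ) n, c k * t ^ k

theorem laurentSum_mem (n : ℕ) (c : ℤ → ℂ) : laurentSum n c ∈ laurentFun :=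
  laurentFun.sum_zpow_mem _ c fun k => k

theorem laurentSum_mul_zpow (n : ℕ) (c : ℤ → ℂ) {t : ℂ} (ht : t ≠ 0) (j : ℤ) :
    laurentSum n c t * t ^ j = ∑ k ∈ Finset.Icc (-n : ℤ) n, c k * t ^ (k + j) := by
  rw [laurentSum, Finset.sum_mul]
  exact Finset.sum_congr rfl fun k _ => by rw [zpow_add₀ ht]; ring

/-- The functions `t ^ i` and `x(t) * t ^ i` with `-n < i ≤ n`. -/
noncomputable def windowFun (n : ℕ) (c : ℤ → ℂ) : Fin (2 * n) ⊕ Fin (2 * n) → ℂˣ → ℂ :=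
  Sum.elim (fun i t => (t : ℂ) ^ ((i : ℤ) - n + 1))
    (fun i t => laurentSum n c t * (t : ℂ) ^ ((i : ℤ) - n + 1))

theorem zpow_mem_span_window (n : ℕ) (c : ℤ → ℂ) {j : ℤ} (h1 : -n < j) (h2 : j ≤ n) :
    (fun t : ℂˣ => (t : ℂ) ^ j) ∈ Submodule.span ℂ (Set.range (windowFun n c)) := by
  refine Submodule.subset_span ⟨Sum.inl ⟨(j + n - 1).toNat, by omega⟩, ?_⟩
  ext t
  simp only [windowFun, Sum.elim_inl]
  congr 1
  omega

theorem mul_zpow_mem_span_window (n : ℕ) (c : ℤ → ℂ) {j : ℤ} (h1 : -n < j) (h2 : j ≤ n) :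
    (fun t : ℂˣ => laurentSum n c t * (t : ℂ) ^ j) ∈
      Submodule.span ℂ (Set.range (windowFun n c)) := by
  refine Submodule.subset_span ⟨Sum.inr ⟨(j + n - 1).toNat, by omega⟩, ?_⟩
  ext t
  simp only [windowFun, Sum.elim_inr]
  congr 2
  omega

/-- If one term of the expansion of `x(t) * t ^ j` has nonzero coefficient and the others lie in
a submodule containing `x(t) * t ^ j`, so does that term. -/
theorem zpow_mem_of_others {S : Submodule ℂ (ℂˣ → ℂ)} {n : ℕ} {c : ℤ → ℂ} {j k₀ : ℤ}
    (hk₀ : k₀ ∈ Finset.Icc (-n : ℤ) n) (hc : c k₀ ≠ 0)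
    (hx : (fun t : ℂˣ => laurentSum n c t * (t : ℂ) ^ j) ∈ S)
    (ho : ∀ k ∈ Finset.Icc (-n : ℤ) n, k ≠ k₀ → (fun t : ℂˣ => (t : ℂ) ^ (k + j)) ∈ S) :
    (fun t : ℂˣ => (t : ℂ) ^ (k₀ + j)) ∈ S := by
  have h1 : (fun t : ℂˣ => laurentSum n c t * (t : ℂ) ^ j) -
      ∑ k ∈ (Finset.Icc (-n : ℤ) n).erase k₀, c k • (fun t : ℂˣ => (t : ℂ) ^ (k + j)) ∈ S := by
    refine S.sub_mem hx (S.sum_mem fun k hk => S.smul_mem _ (ho k ?_ ?_))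
    · exact Finset.mem_of_mem_erase hk
    · exact Finset.ne_of_mem_erase hk
  have h2 := S.smul_mem (c k₀)⁻¹ h1
  convert h2 using 1
  ext t
  simp only [Pi.smul_apply, Pi.sub_apply, Finset.sum_apply, smul_eq_mul,
    laurentSum_mul_zpow n c t.ne_zero j, ← Finset.add_sum_erase _ _ hk₀]
  field_simp
  ring

/-- Induction on the excess m: a new power t^j is the top term of x·t^(j-n), whose other exponents
are smaller but still exceed -n. The bound m ≤ n keeps j - n in the window. -/
theorem zpow_mem_span_window_of_le (n : ℕ) (c : ℤ → ℂ) (hc : c n ≠ 0) (m : ℕ) :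
    ∀ j : ℤ, -n < j → j ≤ n + m → m ≤ n →
    (fun t : ℂˣ => (t : ℂ) ^ j) ∈ Submodule.span ℂ (Set.range (windowFun n c)) := by
  induction m with
  | zero => exact fun j h1 h2 _ => zpow_mem_span_window n c h1 (by simpa using h2)
  | succ m ih =>
    intro j h1 h2 h3
    by_cases hj : j ≤ n + m
    · exact ih j h1 hj (by omega)
    have := zpow_mem_of_others (S := Submodule.span ℂ (Set.range (windowFun n c)))
      (n := n) (c := c) (j := j - n) (k₀ := n) (by simp) hc
      (mul_zpow_mem_span_window n c (by omega) (by push_cast at h2; omega))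
      (fun k hk hne => ih _ (by simp at hk; omega) (by simp at hk; omega) (by omega))
    simpa using this

/-- The same induction downwards, isolating the bottom term of x·t^(j+n). At m = n all exponents in
(-2n, 2n] are reached. -/
theorem zpow_mem_span_window_of_ge (n : ℕ) (c : ℤ → ℂ) (hc : c n ≠ 0) (hc' : c (-n) ≠ 0) (m : ℕ) :
    ∀ j : ℤ, -n - m < j → j ≤ 2 * n → m ≤ n →
    (fun t : ℂˣ => (t : ℂ) ^ j) ∈ Submodule.span ℂ (Set.range (windowFun n c)) := by
  induction m with
  | zero =>
    exact fun j h1 h2 _ => zpow_mem_span_window_of_le n c hc n j (by simpa using h1)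
      (by omega) le_rfl
  | succ m ih =>
    intro j h1 h2 h3
    by_cases hj : -n - m < j
    · exact ih j hj h2 (by omega)
    push_cast at h1
    have := zpow_mem_of_others (S := Submodule.span ℂ (Set.range (windowFun n c)))
      (n := n) (c := c) (j := j + n) (k₀ := -n) (by simp) hc'
      (mul_zpow_mem_span_window n c (by omega) (by omega))
      (fun k hk hne => ih _ (by simp at hk; omega) (by simp at hk; omega) (by omega))
    simpa using this

/-- The exponents in the product of a window power with a second Laurent polynomial fill at most
(-2n, 2n], exactly the range covered above. -/
theorem laurentSum_mul_window_mem (n : ℕ) (c d : ℤ → ℂ) (hc : c n ≠ 0) (hc' : c (-n) ≠ 0)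
    (i : Fin (2 * n)) :
    (fun t : ℂˣ => laurentSum n d t * (t : ℂ) ^ ((i : ℤ) - n + 1)) ∈
      Submodule.span ℂ (Set.range (windowFun n c)) := by
  have h : ∑ k ∈ Finset.Icc (-n : ℤ) n, d k • (fun t : ℂˣ => (t : ℂ) ^ (k + ((i : ℤ) - n + 1))) ∈
      Submodule.span ℂ (Set.range (windowFun n c)) := by
    refine Submodule.sum_mem _ fun k hk => Submodule.smul_mem _ _ ?_
    have := i.2
    rw [Finset.mem_Icc] at hk
    exact zpow_mem_span_window_of_ge n c hc hc' n _ (by omega) (by omega) le_rfl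
  convert h using 1
  ext t
  simp [laurentSum_mul_zpow n d t.ne_zero]

open MvPolynomial in
/-- Two Laurent polynomials with exponents in `[-n, n]`, the first with both extreme coefficients
nonzero, satisfy an algebraic relation of total degree at most `2 * n`. -/
theorem exists_relation_totalDegree_le (n : ℕ) (hn : 1 ≤ n) (c d : ℤ → ℂ)
    (hc : c n ≠ 0) (hc' : c (-n) ≠ 0) :
    ∃ g : MvPolynomial (Fin 2) ℂ, g ≠ 0 ∧ g.totalDegree ≤ 2 * n ∧
      ∀ t : ℂ, t ≠ 0 → eval ![laurentSum n c t, laurentSum n d t] g = 0 := by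
  have hcoef (i : Fin (2 * n)) :=
    (Submodule.mem_span_range_iff_exists_fun ℂ).1 (laurentSum_mul_window_mem n c d hc hc' i)
  choose w hw using hcoef
  -- The expansions read y·v = (A + x·A')·v for the vector v of window powers, so v lies in the
  -- kernel of B = y - A - x·A' along the curve. The determinant of B has degree at most 2n because
  -- its entries are affine; at x = 0 it is the characteristic polynomial of A, hence nonzero.
  let A : Matrix (Fin (2 * n)) (Fin (2 * n)) ℂ := Matrix.of fun i k => w i (Sum.inl k)
  let B : Matrix (Fin (2 * n)) (Fin (2 * n)) (MvPolynomial (Fin 2) ℂ) := Matrix.of fun i k =>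
    (if i = k then X 1 else 0) - C (w i (Sum.inl k)) - C (w i (Sum.inr k)) * X 0
  refine ⟨B.det, ?_, ?_, ?_⟩
  · intro h0
    have hA : A.charpoly ≠ 0 := A.charpoly_monic.ne_zero
    refine hA (Polynomial.funext fun z => ?_)
    rw [Matrix.eval_charpoly, Polynomial.eval_zero]
    have h1 := congrArg (eval ![0, z]) h0
    rw [RingHom.map_det, map_zero] at h1
    rw [← h1]
    congr 1
    ext i k
    by_cases hik : i = k <;> simp [A, B, hik]
  · rw [Matrix.det_apply]
    refine (totalDegree_finsetSum _ _).trans (Finset.sup_le fun σ _ => ?_)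
    refine (totalDegree_smul_le _ _).trans ((totalDegree_finsetProd _ _).trans ?_)
    refine (Finset.sum_le_card_nsmul _ _ 1 fun i _ => ?_).trans (by simp)
    refine (totalDegree_sub _ _).trans (max_le ((totalDegree_sub _ _).trans (max_le ?_ ?_)) ?_)
    · split_ifs <;> simp
    · simp
    · exact (totalDegree_mul _ _).trans (by simp)
  · intro t ht
    rw [RingHom.map_det, ← Matrix.exists_mulVec_eq_zero_iff]
    refine ⟨fun i => t ^ ((i : ℤ) - n + 1), fun h => ?_, ?_⟩
    · exact zpow_ne_zero _ ht (congrFun h ⟨0, by omega⟩)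
    · ext i
      have h := congrFun (hw i) (Units.mk0 t ht)
      simp only [windowFun, Fintype.sum_sum_type, Sum.elim_inl, Sum.elim_inr,
        Finset.sum_apply, Pi.smul_apply, smul_eq_mul, Units.val_mk0] at h
      simp only [Matrix.mulVec, dotProduct, B, RingHom.mapMatrix_apply, Matrix.map_apply,
        Matrix.of_apply, map_sub, map_mul, eval_C, eval_X, Matrix.cons_val_zero, sub_mul,
        Finset.sum_sub_distrib, Pi.zero_apply, apply_ite (eval _), map_zero,
        Matrix.cons_val_one, ite_mul, zero_mul, Finset.sum_ite_eq, Finset.mem_univ, if_true]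
      rw [← h]
      simp only [mul_assoc]
      ring

/-! ### Lower bound for the degree: generic vertical lines -/

open Polynomial in
/-- The polynomial `t ^ n * x(t)` where `x` is a Laurent polynomial with exponents in `[-n, n]`. -/
noncomputable def laurentNumerator (n : ℕ) (c : ℤ → ℂ) : ℂ[X] :=
  ∑ j ∈ Finset.range (2 * n + 1), C (c ((j : ℤ) - n)) * X ^ j

open Polynomial in
theorem coeff_laurentNumerator (n : ℕ) (c : ℤ → ℂ) (j : ℕ) :
    (laurentNumerator n c).coeff j = if j ≤ 2 * n then c ((j : ℤ) - n) else 0 := by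
  simp [laurentNumerator, coeff_C_mul, coeff_X_pow]

theorem eval_laurentNumerator (n : ℕ) (c : ℤ → ℂ) {t : ℂ} (ht : t ≠ 0) :
    (laurentNumerator n c).eval t = t ^ n * laurentSum n c t := by
  rw [mul_comm, ← zpow_natCast, laurentSum_mul_zpow n c ht, laurentNumerator,
    Polynomial.eval_finsetSum]
  refine Finset.sum_bij (fun j _ => (j : ℤ) - n) ?_ ?_ ?_ ?_
  · intro j hj
    simp at hj ⊢
    omega
  · intro i _ j _ h
    simpa using h
  · intro k hk
    rw [Finset.mem_Icc] at hk
    exact ⟨(k + n).toNat, by simp; omega, by omega⟩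
  · intro j _
    simp

theorem natDegree_laurentNumerator_le (n : ℕ) (c : ℤ → ℂ) :
    (laurentNumerator n c).natDegree ≤ 2 * n := by
  rw [Polynomial.natDegree_le_iff_coeff_eq_zero]
  intro j hj
  rw [coeff_laurentNumerator, if_neg (by omega)]

/-- The coefficients of a Laurent polynomial are determined by its values. -/
theorem coeff_eq_zero_of_laurentSum_eq_zero {n : ℕ} {c : ℤ → ℂ}
    (h : ∀ t ≠ 0, laurentSum n c t = 0) {k : ℤ} (hk : k ∈ Finset.Icc (-n : ℤ) n) : c k = 0 := by
  have h0 : laurentNumerator n c = 0 := by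
    refine Polynomial.eq_zero_of_infinite_isRoot _ ?_
    refine (Set.Finite.infinite_compl (Set.finite_singleton (0 : ℂ))).mono fun t ht => ?_
    simp [Polynomial.IsRoot, eval_laurentNumerator n c ht, h t ht]
  have h1 := coeff_laurentNumerator n c (k + n).toNat
  rw [Finset.mem_Icc] at hk
  rw [h0, Polynomial.coeff_zero, if_pos (by omega)] at h1
  rw [h1]
  congr 1
  omega

theorem hasDerivAt_laurentSum (n : ℕ) (c : ℤ → ℂ) {t : ℂ} (ht : t ≠ 0) :
    HasDerivAt (laurentSum n c) (laurentSum n (fun k => k * c k) t / t) t := by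
  have h : HasDerivAt (laurentSum n c)
      (∑ k ∈ Finset.Icc (-n : ℤ) n, c k * (k * t ^ (k - 1))) t :=
    HasDerivAt.fun_sum fun k _ => (hasDerivAt_zpow k t (Or.inl ht)).const_mul _
  convert h using 1
  rw [laurentSum, Finset.sum_div]
  refine Finset.sum_congr rfl fun k _ => ?_
  rw [zpow_sub_one₀ ht]
  ring

/-- A fibre of a Laurent polynomial away from its critical values has `2 * n` elements. -/
theorem exists_fibre (n : ℕ) (hn : 1 ≤ n) (c : ℤ → ℂ) (hc : c n ≠ 0) (hc' : c (-n) ≠ 0) (z : ℂ)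
    (hz : ∀ t ≠ 0, laurentSum n c t = z → laurentSum n (fun k => k * c k) t ≠ 0) :
    ∃ R : Finset ℂ, R.card = 2 * n ∧ ∀ t ∈ R, t ≠ 0 ∧ laurentSum n c t = z := by
  classical
  -- Clearing denominators in x(t) = z. As n ≥ 1, subtracting z·t^n changes neither the constant nor
  -- the leading coefficient, so q has degree 2n and no root at 0; a multiple root would be a
  -- critical point of x.
  let q : Polynomial ℂ := laurentNumerator n c - Polynomial.C z * Polynomial.X ^ n
  have hq (t : ℂ) (ht : t ≠ 0) : q.eval t = t ^ n * (laurentSum n c t - z) := by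
    simp only [q, Polynomial.eval_sub, eval_laurentNumerator n c ht, Polynomial.eval_mul,
      Polynomial.eval_C, Polynomial.eval_pow, Polynomial.eval_X]
    ring
  have hq0 : q.eval 0 ≠ 0 := by
    rw [← Polynomial.coeff_zero_eq_eval_zero]
    simpa [q, coeff_laurentNumerator, Polynomial.coeff_X_pow, show 0 ≠ n by omega] using hc'
  have hdeg : q.natDegree = 2 * n := by
    refine Polynomial.natDegree_eq_of_le_of_coeff_ne_zero ?_ ?_
    · refine (Polynomial.natDegree_sub_le _ _).trans (max_le (natDegree_laurentNumerator_le n c) ?_)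
      exact (Polynomial.natDegree_C_mul_X_pow_le _ _).trans (by omega)
    · have : (2 * (n : ℤ) - n) = n := by ring
      simpa [q, coeff_laurentNumerator, Polynomial.coeff_X_pow, show 2 * n ≠ n by omega,
        this] using hc
  have hqne : q ≠ 0 := by
    intro h
    simp [h] at hq0
  have hroot (t : ℂ) (ht : q.IsRoot t) : t ≠ 0 ∧ laurentSum n c t = z := by
    have h0 : t ≠ 0 := by
      rintro rfl
      exact hq0 ht
    have := (hq t h0).symm.trans ht
    exact ⟨h0, by simpa [h0, sub_eq_zero] using this⟩
  have hnodup : q.roots.Nodup := by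
    rw [Multiset.nodup_iff_count_le_one]
    intro t
    rw [Polynomial.count_roots]
    by_contra hcon
    obtain ⟨h1, h2⟩ := (Polynomial.one_lt_rootMultiplicity_iff_isRoot hqne).1 (not_le.1 hcon)
    obtain ⟨h0, hxz⟩ := hroot t h1
    have hd1 := q.hasDerivAt t
    have hd2 := (hasDerivAt_pow n t).mul ((hasDerivAt_laurentSum n c h0).sub_const z)
    have heq : (fun s => q.eval s) =ᶠ[nhds t] (fun s => s ^ n) * fun s => laurentSum n c s - z := by
      filter_upwards [isOpen_ne.mem_nhds h0] with s hs
      exact hq s hs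
    have := (hd2.congr_of_eventuallyEq heq).unique hd1
    rw [h2.eq_zero, hxz] at this
    simp [h0, hz t h0 hxz] at this
  refine ⟨q.roots.toFinset, ?_, fun t ht => hroot t ?_⟩
  · rw [Multiset.toFinset_card_of_nodup hnodup, ← hdeg]
    exact (IsAlgClosed.splits q).natDegree_eq_card_roots.symm
  · rw [Multiset.mem_toFinset] at ht
    exact (Polynomial.mem_roots'.1 ht).2

theorem eval_aeval_vertical (f : MvPolynomial (Fin 2) ℂ) (z w : ℂ) :
    (MvPolynomial.aeval ![Polynomial.C z, Polynomial.X] f).eval w =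
      MvPolynomial.eval ![z, w] f := by
  rw [MvPolynomial.aeval_def, ← Polynomial.coe_evalRingHom, MvPolynomial.hom_eval₂,
    MvPolynomial.eval, MvPolynomial.eval₂Hom]
  simp only [RingHom.coe_mk, MonoidHom.coe_mk, OneHom.coe_mk]
  congr 1
  · ext; simp
  · ext i
    fin_cases i <;> simp

/-- A nonzero polynomial vanishing on a curve parametrized, injectively up to finitely many
parameters, by Laurent polynomials with exponents in `[-n, n]`, the first with nonzero extreme
coefficients, has total degree at least `2 * n`. -/
theorem two_mul_le_totalDegree (n : ℕ) (hn : 1 ≤ n) (c d : ℤ → ℂ) (hc : c n ≠ 0)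
    (hc' : c (-n) ≠ 0) (f : MvPolynomial (Fin 2) ℂ) (hf0 : f ≠ 0)
    (hf : ∀ t ≠ 0, MvPolynomial.eval ![laurentSum n c t, laurentSum n d t] f = 0)
    {E : Set ℂ} (hE : E.Finite)
    (hinj : ∀ t ≠ 0, t ∉ E → ∀ s ≠ 0, laurentSum n c s = laurentSum n c t →
      laurentSum n d s = laurentSum n d t → s = t) :
    2 * n ≤ f.totalDegree := by
  classical
  -- Only finitely many vertical lines lie in the zero set of f: otherwise f would vanish on the
  -- product of an infinite set with ℂ.
  have h1 : {z : ℂ | MvPolynomial.aeval ![Polynomial.C z, Polynomial.X] f = 0}.Finite := by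
    by_contra hinf
    refine hf0 (MvPolynomial.funext_set
      ![{z : ℂ | MvPolynomial.aeval ![Polynomial.C z, Polynomial.X] f = 0}, Set.univ] ?_ ?_)
    · intro i
      fin_cases i
      · exact hinf
      · exact Set.infinite_univ
    · intro v hv
      have hv0 : MvPolynomial.aeval ![Polynomial.C (v 0), Polynomial.X] f = 0 := by
        simpa using hv 0 trivial
      have := eval_aeval_vertical f (v 0) (v 1)
      rw [hv0, Polynomial.eval_zero] at this
      rw [map_zero, this]
      congr 2
      ext i
      fin_cases i <;> rfl
  have h2 : {t | t ≠ 0 ∧ laurentSum n (fun k => k * c k) t = 0}.Finite := by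
    by_contra hinf
    have h3 := laurentFun.eq_zero_of_infinite (laurentSum_mem n fun k => k * c k) hinf
      fun t ht _ => ht.2
    have := coeff_eq_zero_of_laurentSum_eq_zero h3 (k := n) (by simp)
    simp [hc] at this
    omega
  -- A generic z: its vertical line is not contained in the zero set, it is not a critical value of
  -- x, and no exceptional parameter lies over it.
  obtain ⟨z, hz⟩ := ((h1.union (hE.image (laurentSum n c))).union
    (h2.image (laurentSum n c))).infinite_compl.nonempty
  simp only [Set.mem_compl_iff, Set.mem_union, not_or, Set.mem_ofPred_eq, Set.mem_image,
    not_exists, not_and] at hz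
  obtain ⟨⟨hz1, hz2⟩, hz3⟩ := hz
  obtain ⟨R, hR, hRt⟩ := exists_fibre n hn c hc hc' z fun t ht hx h => hz3 t ⟨ht, h⟩ hx
  have hinjR : Set.InjOn (laurentSum n d) (R : Set ℂ) := by
    intro s hs t ht hst
    obtain ⟨hs0, hsz⟩ := hRt s hs
    obtain ⟨ht0, htz⟩ := hRt t ht
    exact hinj t ht0 (fun h => hz2 t h htz) s hs0 (hsz.trans htz.symm) hst
  rw [← hR, ← Finset.card_image_of_injOn hinjR]
  refine (Polynomial.card_le_degree_of_subset_roots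
    (p := MvPolynomial.aeval ![Polynomial.C z, Polynomial.X] f) ?_).trans ?_
  · intro w hw
    simp only [Finset.mem_val, Finset.mem_image] at hw
    obtain ⟨t, ht, rfl⟩ := hw
    obtain ⟨ht0, htz⟩ := hRt t ht
    rw [Polynomial.mem_roots hz1, Polynomial.IsRoot, eval_aeval_vertical, ← htz]
    exact hf t ht0
  · simpa using MvPolynomial.aeval_natDegree_le (n := 1) f le_rfl
      ![Polynomial.C z, Polynomial.X] (fun i => by fin_cases i <;> simp)

/-! ### Partial derivatives, and real and imaginary parts of polynomials -/

open MvPolynomial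

theorem add_single_mem_support_of_mem_support_pderiv {σ R : Type*} [CommSemiring R] {i : σ}
    {f : MvPolynomial σ R} {m : σ →₀ ℕ} (hm : m ∈ (pderiv i f).support) :
    m + Finsupp.single i 1 ∈ f.support := by
  rw [mem_support_iff, coeff_pderiv] at hm
  exact mem_support_iff.2 (left_ne_zero_of_mul hm)

theorem totalDegree_pderiv_lt {σ R : Type*} [CommSemiring R] {i : σ} {f : MvPolynomial σ R}
    (h : pderiv i f ≠ 0) : (pderiv i f).totalDegree < f.totalDegree := by
  have key : ∀ m ∈ (pderiv i f).support, (m.sum fun _ e => e) < f.totalDegree := by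
    intro m hm
    have := le_totalDegree (add_single_mem_support_of_mem_support_pderiv hm)
    rw [Finsupp.sum_add_index' (fun _ => rfl) (fun _ _ _ => rfl),
      Finsupp.sum_single_index rfl] at this
    omega
  obtain ⟨m, hm⟩ := support_nonempty.2 h
  exact (Finset.sup_lt_iff ((Nat.zero_le _).trans_lt (key m hm))).2 key

/-- A nonzero partial derivative has smaller total degree than f, while a nonzero multiple of f does
not. -/
theorem pderiv_eq_zero_of_dvd {σ R : Type*} [CommRing R] [IsDomain R] {i : σ}
    {f : MvPolynomial σ R} (h : f ∣ pderiv i f) : pderiv i f = 0 := by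
  by_contra h0
  obtain ⟨g, hg⟩ := h
  have h1 := totalDegree_pderiv_lt h0
  have hf : f ≠ 0 := by
    rintro rfl
    simp at h0
  have hg0 : g ≠ 0 := by
    rintro rfl
    simp [hg] at h0
  rw [hg, totalDegree_mul_of_isDomain hf hg0] at h1
  omega

theorem eq_C_of_pderiv_eq_zero {σ R : Type*} [CommRing R] [IsDomain R] [CharZero R]
    {f : MvPolynomial σ R} (h : ∀ i, pderiv i f = 0) : f = C (coeff 0 f) := by
  classical
  ext m
  rw [coeff_C]
  split_ifs with hm
  · rw [hm]
  obtain ⟨i, hi⟩ : ∃ i, m i ≠ 0 := by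
    by_contra! hcon
    exact hm (Finsupp.ext fun i => (hcon i).symm)
  have h1 := congrArg (coeff (m - Finsupp.single i 1)) (h i)
  rw [coeff_pderiv, coeff_zero, tsub_add_cancel_of_le] at h1
  · refine (mul_eq_zero.1 h1).resolve_right ?_
    exact Nat.cast_add_one_ne_zero _
  · rw [Finsupp.single_le_iff]
    omega

/-- The chain rule for a polynomial in two functions. -/
theorem hasDerivAt_eval_pair {x y : ℂ → ℂ} {x' y' t : ℂ} (hx : HasDerivAt x x' t)
    (hy : HasDerivAt y y' t) (f : MvPolynomial (Fin 2) ℂ) :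
    HasDerivAt (fun s => eval ![x s, y s] f)
      (eval ![x t, y t] (pderiv 0 f) * x' + eval ![x t, y t] (pderiv 1 f) * y') t := by
  induction f using MvPolynomial.induction_on with
  | C a => simpa using hasDerivAt_const t a
  | add p q hp hq =>
    simp only [map_add]
    exact (hp.fun_add hq).congr_deriv (by ring)
  | mul_X p i hp =>
    simp only [map_mul, pderiv_mul, map_add, eval_X]
    fin_cases i
    · refine (hp.fun_mul hx).congr_deriv ?_
      simp [pderiv_X]
      ring
    · refine (hp.fun_mul hy).congr_deriv ?_
      simp [pderiv_X]
      ring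

/-- Every complex polynomial is `g₁ + i g₂` with `g₁`, `g₂` real of no larger degree. -/
theorem exists_real_imaginary_parts {σ : Type*} (g : MvPolynomial σ ℂ) :
    ∃ g₁ g₂ : MvPolynomial σ ℝ, g₁.totalDegree ≤ g.totalDegree ∧
      g₂.totalDegree ≤ g.totalDegree ∧
      g = map (algebraMap ℝ ℂ) g₁ + C Complex.I * map (algebraMap ℝ ℂ) g₂ := by
  have hdeg (r : ℂ → ℝ) :
      (∑ m ∈ g.support, monomial m (r (coeff m g))).totalDegree ≤ g.totalDegree := by
    refine (totalDegree_finsetSum _ _).trans (Finset.sup_le fun m hm => ?_)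
    exact (totalDegree_monomial_le _ _).trans (le_totalDegree hm)
  refine ⟨∑ m ∈ g.support, monomial m (coeff m g).re, ∑ m ∈ g.support, monomial m (coeff m g).im,
    hdeg Complex.re, hdeg Complex.im, ?_⟩
  conv_lhs => rw [← support_sum_monomial_coeff g]
  simp only [map_sum, map_monomial, Finset.mul_sum, C_mul_monomial, ← Finset.sum_add_distrib,
    ← map_add]
  refine Finset.sum_congr rfl fun m _ => ?_
  congr 1
  rw [mul_comm]
  exact (Complex.re_add_im _).symm

/-! ### The vanishing ideal of a Laurent-parametrized curve -/

/-- `γ` is given on the unit circle by the Laurent polynomials `x` and `y`. -/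
structure IsLaurentParam (γ : ℝ → Fin 2 → ℝ) (x y : ℂ → ℂ) : Prop where
  fst_mem : x ∈ laurentFun
  snd_mem : y ∈ laurentFun
  fst_eq : ∀ θ : ℝ, (γ θ 0 : ℂ) = x (Complex.exp (θ * Complex.I))
  snd_eq : ∀ θ : ℝ, (γ θ 1 : ℂ) = y (Complex.exp (θ * Complex.I))

namespace IsLaurentParam

variable {γ : ℝ → Fin 2 → ℝ} {x y : ℂ → ℂ}

theorem eval_map_eq (h : IsLaurentParam γ x y) (f : MvPolynomial (Fin 2) ℝ) (θ : ℝ) :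
    eval ![x (Complex.exp (θ * Complex.I)), y (Complex.exp (θ * Complex.I))]
      (map (algebraMap ℝ ℂ) f) = ((aeval (γ θ) f : ℝ) : ℂ) := by
  rw [← h.fst_eq, ← h.snd_eq, MvPolynomial.eval_map, ← Complex.coe_algebraMap, ← aeval_algebraMap_apply,
    aeval_def]
  congr 1
  ext i
  fin_cases i <;> simp

/-- The pullback is a Laurent polynomial, so vanishing on the infinite unit circle spreads to all t
≠ 0. -/
theorem mem_vanishingIdeal_iff (h : IsLaurentParam γ x y) (f : MvPolynomial (Fin 2) ℝ) :
    f ∈ vanishingIdeal ℝ (Set.range γ) ↔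
      ∀ t ≠ 0, eval ![x t, y t] (map (algebraMap ℝ ℂ) f) = 0 := by
  rw [MvPolynomial.mem_vanishingIdeal_iff, Set.forall_mem_range]
  constructor
  · intro hf
    refine laurentFun.eq_zero_of_infinite (laurentFun.eval_mem h.fst_mem h.snd_mem _)
      infinite_range_exp_mul_I ?_
    rintro _ ⟨θ, rfl⟩ -
    rw [h.eval_map_eq, hf, Complex.ofReal_zero]
  · intro hf θ
    have := hf _ (Complex.exp_ne_zero (θ * Complex.I))
    rw [h.eval_map_eq] at this
    exact_mod_cast this

/-- Laurent polynomials have no zero divisors: where one factor is not identically zero, the other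
vanishes off a finite set, hence everywhere on t ≠ 0. -/
theorem isPrime_vanishingIdeal (h : IsLaurentParam γ x y) :
    (vanishingIdeal ℝ (Set.range γ)).IsPrime := by
  refine Ideal.isPrime_iff.2 ⟨fun htop => ?_, fun {f g} hfg => ?_⟩
  · have := (h.mem_vanishingIdeal_iff 1).1 (htop ▸ Submodule.mem_top) 1 one_ne_zero
    simp at this
  · by_contra! hcon
    obtain ⟨hf, hg⟩ := hcon
    rw [h.mem_vanishingIdeal_iff] at hf hg hfg
    push Not at hf
    obtain ⟨t₀, ht₀, hft₀⟩ := hf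
    have hfin := laurentFun.finite_zeros (laurentFun.eval_mem h.fst_mem h.snd_mem _) ht₀ hft₀
    refine hg (laurentFun.eq_zero_of_infinite (laurentFun.eval_mem h.fst_mem h.snd_mem _)
      hfin.infinite_compl fun t ht ht0 => ?_)
    have := hfg t ht0
    rw [map_mul, map_mul, mul_eq_zero] at this
    exact this.resolve_left fun h0 => ht ⟨ht0, h0⟩

/-- A complex relation between `x` and `y` gives a real one of no larger degree. -/
theorem exists_mem_vanishingIdeal (h : IsLaurentParam γ x y) {g : MvPolynomial (Fin 2) ℂ}
    (hg0 : g ≠ 0) (hg : ∀ t ≠ 0, eval ![x t, y t] g = 0) :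
    ∃ f ∈ vanishingIdeal ℝ (Set.range γ), f ≠ 0 ∧ f.totalDegree ≤ g.totalDegree := by
  obtain ⟨g₁, g₂, hd₁, hd₂, rfl⟩ := exists_real_imaginary_parts g
  -- At real θ the point is real, so the values of g₁ and g₂ are the real and imaginary parts of 0.
  have key (θ : ℝ) : aeval (γ θ) g₁ = 0 ∧ aeval (γ θ) g₂ = 0 := by
    have := hg _ (Complex.exp_ne_zero (θ * Complex.I))
    rw [map_add, map_mul, eval_C, h.eval_map_eq, h.eval_map_eq] at this
    have h1 := congrArg Complex.re this
    have h2 := congrArg Complex.im this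
    simp at h1 h2
    exact ⟨h1, h2⟩
  by_cases h1 : g₁ = 0
  · refine ⟨g₂, ?_, fun h2 => hg0 (by simp [h1, h2]), hd₂⟩
    rw [MvPolynomial.mem_vanishingIdeal_iff, Set.forall_mem_range]
    exact fun θ => (key θ).2
  · refine ⟨g₁, ?_, h1, hd₁⟩
    rw [MvPolynomial.mem_vanishingIdeal_iff, Set.forall_mem_range]
    exact fun θ => (key θ).1

end IsLaurentParam

/-- A nonzero prime vanishing ideal of a plane set with at least two points is generated by an
irreducible polynomial. -/
theorem exists_isDefiningPolynomial {S : Set (Fin 2 → ℝ)}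
    (hprime : (vanishingIdeal ℝ S : Ideal (MvPolynomial (Fin 2) ℝ)).IsPrime)
    (hne : (vanishingIdeal ℝ S : Ideal (MvPolynomial (Fin 2) ℝ)) ≠ ⊥) (hS : S.Nontrivial) :
    ∃ f, IsDefiningPolynomial S f := by
  obtain ⟨f, hf, hfp⟩ := hprime.exists_mem_prime_of_ne_bot hne
  refine ⟨f, hfp.irreducible, ?_⟩
  by_contra hcon
  have hfI : Ideal.span {f} ≤ (vanishingIdeal ℝ S : Ideal (MvPolynomial (Fin 2) ℝ)) := by
    rwa [Ideal.span_singleton_le_iff_mem]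
  have hlt1 : Ideal.span {f} < (vanishingIdeal ℝ S : Ideal (MvPolynomial (Fin 2) ℝ)) :=
    lt_of_le_of_ne hfI fun h => hcon h.symm
  have hlt0 : (⊥ : Ideal (MvPolynomial (Fin 2) ℝ)) < Ideal.span {f} :=
    bot_lt_iff_ne_bot.2 fun h => hfp.ne_zero (Ideal.span_singleton_eq_bot.1 h)
  obtain ⟨P, hP, Q, hQ, hPQ⟩ := hS
  have hlt2 : (vanishingIdeal ℝ S : Ideal (MvPolynomial (Fin 2) ℝ)) < vanishingIdeal ℝ {P} := by
    refine lt_of_le_of_ne (vanishingIdeal_anti_mono (by simpa using hP)) fun h => hPQ ?_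
    ext i
    have hmem : X i - C (P i) ∈ (vanishingIdeal ℝ {P} : Ideal (MvPolynomial (Fin 2) ℝ)) := by
      rw [mem_vanishingIdeal_iff]
      simp
    rw [← h, mem_vanishingIdeal_iff] at hmem
    have := hmem Q hQ
    simp only [map_sub, aeval_X, aeval_C, Algebra.algebraMap_self, RingHom.id_apply] at this
    linarith
  -- If the ideal I of S were strictly larger than (f), the primes 0 < (f) < I < I(P) would form a
  -- chain of length 3 in a ring of Krull dimension 2. The last inclusion is strict because S has a
  -- second point.
  let c : LTSeries (PrimeSpectrum (MvPolynomial (Fin 2) ℝ)) :=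
    { length := 3
      toFun := ![⟨⊥, Ideal.isPrime_bot⟩,
        ⟨Ideal.span {f}, (Ideal.span_singleton_prime hfp.ne_zero).2 hfp⟩,
        ⟨vanishingIdeal ℝ S, hprime⟩, ⟨vanishingIdeal ℝ {P}, inferInstance⟩]
      step := by
        intro i
        fin_cases i
        · exact hlt0
        · exact hlt1
        · exact hlt2 }
  have h1 : (3 : WithBot ℕ∞) ≤ ringKrullDim (MvPolynomial (Fin 2) ℝ) :=
    Order.LTSeries.length_le_krullDim c
  rw [MvPolynomial.ringKrullDim_of_isNoetherianRing, ringKrullDim_eq_zero_of_field] at h1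
  simp at h1
  exact absurd h1 (by decide)

namespace IsLaurentParam

variable {γ : ℝ → Fin 2 → ℝ} {x y : ℂ → ℂ} {f : MvPolynomial (Fin 2) ℝ}

/-- The gradient of a defining polynomial is nonzero at some point of the curve. -/
theorem exists_gradient_ne_zero (h : IsLaurentParam γ x y)
    (hf : IsDefiningPolynomial (Set.range γ) f) :
    ∃ t ≠ 0, eval ![x t, y t] (map (algebraMap ℝ ℂ) (pderiv 0 f)) -
      Complex.I * eval ![x t, y t] (map (algebraMap ℝ ℂ) (pderiv 1 f)) ≠ 0 := by
  by_contra! hcon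
  -- On the circle both partial derivatives are real, so the vanishing of f_x - i·f_y forces both to
  -- vanish. They are then multiples of f, hence zero, and f would be constant.
  have key (θ : ℝ) : aeval (γ θ) (pderiv 0 f) = 0 ∧ aeval (γ θ) (pderiv 1 f) = 0 := by
    have := hcon _ (Complex.exp_ne_zero (θ * Complex.I))
    rw [h.eval_map_eq, h.eval_map_eq] at this
    have h1 := congrArg Complex.re this
    have h2 := congrArg Complex.im this
    simp at h1 h2
    exact ⟨h1, h2⟩
  have hz (i : Fin 2) : pderiv i f = 0 := by
    refine pderiv_eq_zero_of_dvd ?_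
    rw [← Ideal.mem_span_singleton, ← hf.2, MvPolynomial.mem_vanishingIdeal_iff,
      Set.forall_mem_range]
    intro θ
    fin_cases i
    · exact (key θ).1
    · exact (key θ).2
  have hC := eq_C_of_pderiv_eq_zero hz
  have h0 : coeff 0 f ≠ 0 := by
    intro h0
    rw [h0, C_0] at hC
    exact hf.1.ne_zero hC
  refine hf.1.not_isUnit ?_
  rw [hC]
  exact (isUnit_iff_ne_zero.2 h0).map C

/-- If the tangent direction of the curve at the parameter `t = exp (i θ)` is `(-sin θ, cos θ)`,
then a point determines its parameter up to sign, with finitely many exceptions. -/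
theorem exists_finite_sq_eq (h : IsLaurentParam γ x y)
    (hf : IsDefiningPolynomial (Set.range γ) f) {r : ℂ → ℂ} (hr : r ∈ laurentFun)
    {t₀ : ℂ} (ht₀ : t₀ ≠ 0) (hrt₀ : r t₀ ≠ 0)
    (hx : ∀ t ≠ 0, HasDerivAt x ((t ^ 2 - 1) * r t) t)
    (hy : ∀ t ≠ 0, HasDerivAt y (-Complex.I * (t ^ 2 + 1) * r t) t) :
    ∃ E : Set ℂ, E.Finite ∧ ∀ t ≠ 0, t ∉ E → ∀ s ≠ 0, x s = x t → y s = y t → s ^ 2 = t ^ 2 := by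
  let fx : ℂ → ℂ := fun t => eval ![x t, y t] (map (algebraMap ℝ ℂ) (pderiv 0 f))
  let fy : ℂ → ℂ := fun t => eval ![x t, y t] (map (algebraMap ℝ ℂ) (pderiv 1 f))
  have hfx : fx ∈ laurentFun := laurentFun.eval_mem h.fst_mem h.snd_mem _
  have hfy : fy ∈ laurentFun := laurentFun.eval_mem h.fst_mem h.snd_mem _
  have hzero : ∀ t ≠ 0, eval ![x t, y t] (map (algebraMap ℝ ℂ) f) = 0 := by
    rw [← h.mem_vanishingIdeal_iff, hf.2]
    exact Ideal.mem_span_singleton_self f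
  -- Differentiate f(x(t), y(t)) = 0 and collect powers of t. The factor r is then cancelled away
  -- from its finitely many zeros.
  have hrel : ∀ t ≠ 0, r t * (t ^ 2 * (fx t - Complex.I * fy t) - (fx t + Complex.I * fy t)) = 0 := by
    intro t ht
    have h1 := hasDerivAt_eval_pair (hx t ht) (hy t ht) (map (algebraMap ℝ ℂ) f)
    have h2 : HasDerivAt (fun s => eval ![x s, y s] (map (algebraMap ℝ ℂ) f)) 0 t := by
      refine (hasDerivAt_const t (0 : ℂ)).congr_of_eventuallyEq ?_
      filter_upwards [isOpen_ne.mem_nhds ht] with s hs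
      exact hzero s hs
    have h3 := h1.unique h2
    rw [pderiv_map, pderiv_map] at h3
    linear_combination h3
  have hmem : (fun t => t ^ 2 * (fx t - Complex.I * fy t) - (fx t + Complex.I * fy t)) ∈
      laurentFun := by
    have hIy := laurentFun.const_mul_mem Complex.I hfy
    refine laurentFun.congr_mem (laurentFun.sub_mem (laurentFun.mul_mem (laurentFun.zpow_mem 2)
      (laurentFun.sub_mem hfx hIy)) (laurentFun.add_mem hfx hIy)) fun t _ => ?_
    simp only [Pi.sub_apply, Pi.mul_apply, Pi.add_apply]
    norm_cast
  have hrel' := laurentFun.eq_zero_of_infinite hmem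
    (laurentFun.finite_zeros hr ht₀ hrt₀).infinite_compl
    fun t ht ht0 => (mul_eq_zero.1 (hrel t ht0)).resolve_left fun h0 => ht ⟨ht0, h0⟩
  obtain ⟨t₁, ht₁, hgt₁⟩ := h.exists_gradient_ne_zero hf
  refine ⟨_, laurentFun.finite_zeros
    (laurentFun.sub_mem hfx (laurentFun.const_mul_mem Complex.I hfy)) ht₁ hgt₁, ?_⟩
  intro t ht htE s hs hxs hys
  have hG : fx t - Complex.I * fy t ≠ 0 := fun h0 => htE ⟨ht, h0⟩
  have h1 := hrel' t ht
  have h2 := hrel' s hs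
  have e1 : fx s = fx t := by simp only [fx, hxs, hys]
  have e2 : fy s = fy t := by simp only [fy, hxs, hys]
  rw [e1, e2] at h2
  -- Both s and t satisfy t²(f_x - i·f_y) = f_x + i·f_y with the same gradient, since the gradient
  -- depends only on the point.
  refine mul_right_cancel₀ hG ?_
  linear_combination h2 - h1

/-- The degree of a defining polynomial of a curve whose points are parametrized by Laurent
polynomials in `t ^ m`, injectively up to finitely many values of `t ^ m`. -/
theorem totalDegree_eq (h : IsLaurentParam γ x y) (hf : IsDefiningPolynomial (Set.range γ) f)
    {n m : ℕ} (hn : 1 ≤ n) (hm : m ≠ 0) {c d : ℤ → ℂ} (hc : c n ≠ 0) (hc' : c (-n) ≠ 0)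
    (hx : ∀ t ≠ 0, x t = laurentSum n c (t ^ m)) (hy : ∀ t ≠ 0, y t = laurentSum n d (t ^ m))
    {E : Set ℂ} (hE : E.Finite)
    (hinj : ∀ t ≠ 0, t ∉ E → ∀ s ≠ 0, x s = x t → y s = y t → s ^ m = t ^ m) :
    f.totalDegree = 2 * n := by
  have hf0 : f ≠ 0 := hf.1.ne_zero
  apply le_antisymm
  · obtain ⟨g, hg0, hgd, hg⟩ := exists_relation_totalDegree_le n hn c d hc hc'
    obtain ⟨f₁, hf₁, hf₁0, hf₁d⟩ := h.exists_mem_vanishingIdeal hg0 fun t ht => by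
      rw [hx t ht, hy t ht]
      exact hg _ (pow_ne_zero m ht)
    -- The real relation of degree at most 2n is a nonzero multiple of f, so f has no larger degree.
    rw [hf.2, Ideal.mem_span_singleton] at hf₁
    obtain ⟨q, rfl⟩ := hf₁
    have hq : q ≠ 0 := right_ne_zero_of_mul hf₁0
    rw [totalDegree_mul_of_isDomain hf0 hq] at hf₁d
    omega
  · have hdeg : (map (algebraMap ℝ ℂ) f).totalDegree ≤ f.totalDegree :=
      Finset.sup_mono (support_map_subset _ _)
    refine le_trans ?_ hdeg
    -- Every nonzero τ is an m-th power, so the statements about t descend to the parameter τ = t^m.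
    have hroot : ∀ τ : ℂ, τ ≠ 0 → ∃ t ≠ 0, t ^ m = τ := by
      intro τ hτ
      obtain ⟨t, ht⟩ := IsAlgClosed.exists_pow_nat_eq τ (Nat.pos_of_ne_zero hm)
      refine ⟨t, ?_, ht⟩
      rintro rfl
      rw [zero_pow hm] at ht
      exact hτ ht.symm
    refine two_mul_le_totalDegree n hn c d hc hc' _ ?_ ?_ (E := (fun t => t ^ m) '' E)
      (hE.image _) ?_
    · intro h0
      exact hf0 (map_injective _ (algebraMap ℝ ℂ).injective (by rw [h0, map_zero]))
    · intro τ hτ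
      obtain ⟨t, ht, rfl⟩ := hroot τ hτ
      rw [← hx t ht, ← hy t ht]
      refine (h.mem_vanishingIdeal_iff f).1 ?_ t ht
      rw [hf.2]
      exact Ideal.mem_span_singleton_self f
    · intro τ hτ hτE σ hσ hxσ hyσ
      obtain ⟨t, ht, rfl⟩ := hroot τ hτ
      obtain ⟨s, hs, rfl⟩ := hroot σ hσ
      rw [← hx t ht, ← hx s hs] at hxσ
      rw [← hy t ht, ← hy s hs] at hyσ
      exact hinj t ht (fun h => hτE ⟨t, h, rfl⟩) s hs hxσ hyσ

end IsLaurentParam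

/-! ### Operations on Laurent coefficients -/

theorem laurentSum_add (n : ℕ) (c d : ℤ → ℂ) (t : ℂ) :
    laurentSum n (fun k => c k + d k) t = laurentSum n c t + laurentSum n d t := by
  simp only [laurentSum, add_mul, Finset.sum_add_distrib]

theorem laurentSum_sub (n : ℕ) (c d : ℤ → ℂ) (t : ℂ) :
    laurentSum n (fun k => c k - d k) t = laurentSum n c t - laurentSum n d t := by
  simp only [laurentSum, sub_mul, Finset.sum_sub_distrib]

theorem laurentSum_const_mul (n : ℕ) (z : ℂ) (c : ℤ → ℂ) (t : ℂ) :
    laurentSum n (fun k => z * c k) t = z * laurentSum n c t := by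
  simp only [laurentSum, Finset.mul_sum, mul_assoc]

theorem laurentSum_neg (n : ℕ) (c : ℤ → ℂ) (t : ℂ) :
    laurentSum n c (-t) = laurentSum n (fun k => (-1) ^ k * c k) t := by
  refine Finset.sum_congr rfl fun k _ => ?_
  rw [← neg_one_mul, mul_zpow]
  ring

/-- The wider sum also reads coefficients of c just outside [-n, n]; `hc` makes those terms vanish.
-/
theorem laurentSum_shift_right {n : ℕ} {c : ℤ → ℂ} (hc : ∀ k : ℤ, n < k.natAbs → c k = 0) {t : ℂ}
    (ht : t ≠ 0) : laurentSum (n + 1) (fun k => c (k - 1)) t = t * laurentSum n c t := by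
  have h := laurentSum_mul_zpow n c ht 1
  rw [zpow_one] at h
  rw [mul_comm, h, laurentSum]
  symm
  refine Finset.sum_of_injOn (fun k => k + 1) (by simp [Set.InjOn]) ?_ ?_ ?_
  · intro k hk
    simp at hk ⊢
    omega
  · intro k hk hne
    rw [hc (k - 1), zero_mul]
    by_contra hcon
    exact hne ⟨k - 1, by simp; omega, by simp⟩
  · intro k _
    simp

theorem laurentSum_shift_left {n : ℕ} {c : ℤ → ℂ} (hc : ∀ k : ℤ, n < k.natAbs → c k = 0) {t : ℂ}
    (ht : t ≠ 0) : laurentSum (n + 1) (fun k => c (k + 1)) t = t⁻¹ * laurentSum n c t := by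
  rw [mul_comm, ← zpow_neg_one, laurentSum_mul_zpow n c ht, laurentSum]
  symm
  refine Finset.sum_of_injOn (fun k => k - 1) (by simp [Set.InjOn]) ?_ ?_ ?_
  · intro k hk
    simp at hk ⊢
    omega
  · intro k hk hne
    rw [hc (k + 1), zero_mul]
    by_contra hcon
    exact hne ⟨k + 1, by simp; omega, by simp⟩
  · intro k _
    simp [sub_eq_add_neg]

theorem laurentSum_of_odd_eq_zero {n : ℕ} {c : ℤ → ℂ} (hc : ∀ k : ℤ, Odd k → c k = 0) (t : ℂ) :
    laurentSum (2 * n) c t = laurentSum n (fun k => c (2 * k)) (t ^ 2) := by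
  symm
  refine Finset.sum_of_injOn (fun k => 2 * k) (by simp [Set.InjOn]) ?_ ?_ ?_
  · intro k hk
    simp at hk ⊢
    omega
  · intro k hk hne
    rw [hc k, zero_mul]
    rw [← Int.not_even_iff_odd]
    rintro ⟨j, rfl⟩
    refine hne ⟨j, ?_, by simp; ring⟩
    simp at hk ⊢
    omega
  · intro k _
    rw [zpow_mul]
    norm_cast

theorem laurentSum_eq_add_sum (n : ℕ) (c : ℤ → ℂ) (t : ℂ) :
    laurentSum n c t = c 0 + ∑ k ∈ Finset.Icc 1 n, (c k * t ^ k + c (-k) * (t ^ k)⁻¹) := by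
  induction n with
  | zero => simp [laurentSum]
  | succ n ih =>
    have h : Finset.Icc (-(n + 1 : ℕ) : ℤ) (n + 1 : ℕ) =
        insert ((n + 1 : ℕ) : ℤ) (insert (-(n + 1 : ℕ) : ℤ) (Finset.Icc (-n : ℤ) n)) := by
      ext k
      simp
      omega
    rw [Finset.sum_Icc_succ_top (by omega), ← add_assoc, ← ih, laurentSum, h,
      Finset.sum_insert (by simp; omega), Finset.sum_insert (by simp), laurentSum, zpow_natCast,
      zpow_neg, zpow_natCast]
    ring

/-! ### Fourier coefficients of p and of the curve -/

/-- The complex Fourier coefficients of `trigPoly N a b`. -/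
noncomputable def trigCoeff (N : ℕ) (a b : ℕ → ℝ) (k : ℤ) : ℂ :=
  if N < k.natAbs then 0
  else if k = 0 then a 0
  else (a k.natAbs - k.sign * Complex.I * b k.natAbs) / 2

theorem trigCoeff_eq_zero_of_lt {N : ℕ} (a b : ℕ → ℝ) {k : ℤ} (hk : N < k.natAbs) :
    trigCoeff N a b k = 0 := if_pos hk

theorem trigCoeff_zero (N : ℕ) (a b : ℕ → ℝ) : trigCoeff N a b 0 = a 0 := by
  simp [trigCoeff]

theorem trigCoeff_natCast {N : ℕ} (a b : ℕ → ℝ) {k : ℕ} (h1 : 1 ≤ k) (h2 : k ≤ N) :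
    trigCoeff N a b k = (a k - Complex.I * b k) / 2 := by
  rw [trigCoeff, if_neg (by simpa using h2), if_neg (by omega), Int.sign_eq_one_of_pos (by omega)]
  simp

theorem trigCoeff_neg_natCast {N : ℕ} (a b : ℕ → ℝ) {k : ℕ} (h1 : 1 ≤ k) (h2 : k ≤ N) :
    trigCoeff N a b (-k) = (a k + Complex.I * b k) / 2 := by
  rw [trigCoeff, if_neg (by simpa using h2), if_neg (by omega),
    Int.sign_eq_neg_one_of_neg (by omega)]
  simp

theorem trigCoeff_natCast_eq_zero_iff {N : ℕ} (a b : ℕ → ℝ) {k : ℕ} (h1 : 1 ≤ k) (h2 : k ≤ N) :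
    trigCoeff N a b k = 0 ↔ a k = 0 ∧ b k = 0 := by
  rw [trigCoeff_natCast a b h1 h2, Complex.ext_iff]
  simp

theorem trigCoeff_neg_natCast_eq_zero_iff {N : ℕ} (a b : ℕ → ℝ) {k : ℕ} (h1 : 1 ≤ k)
    (h2 : k ≤ N) : trigCoeff N a b (-k) = 0 ↔ a k = 0 ∧ b k = 0 := by
  rw [trigCoeff_neg_natCast a b h1 h2, Complex.ext_iff]
  simp

theorem trigPoly_eq_laurentSum (N : ℕ) (a b : ℕ → ℝ) (θ : ℝ) :
    (trigPoly N a b θ : ℂ) = laurentSum N (trigCoeff N a b) (Complex.exp (θ * Complex.I)) := by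
  rw [laurentSum_eq_add_sum, trigCoeff_zero, trigPoly]
  push_cast
  congr 1
  refine Finset.sum_congr rfl fun k hk => ?_
  rw [Finset.mem_Icc] at hk
  rw [trigCoeff_natCast a b hk.1 hk.2, trigCoeff_neg_natCast a b hk.1 hk.2, ← Complex.exp_nat_mul,
    ← Complex.exp_neg, ← mul_assoc, ← neg_mul, Complex.exp_mul_I, Complex.exp_mul_I,
    Complex.cos_neg, Complex.sin_neg]
  linear_combination ((b k : ℂ) * Complex.sin (k * θ)) * Complex.I_sq

/-- Along t = exp(iθ) the chain rule gives d/dθ = i·t·d/dt, which multiplies the k-th coefficient by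
ik. -/
theorem deriv_trigPoly_eq_laurentSum (N : ℕ) (a b : ℕ → ℝ) (θ : ℝ) :
    ((deriv (trigPoly N a b) θ : ℝ) : ℂ) =
      Complex.I * laurentSum N (fun k => k * trigCoeff N a b k) (Complex.exp (θ * Complex.I)) := by
  have hp : DifferentiableAt ℝ (trigPoly N a b) θ := by
    unfold trigPoly
    fun_prop
  have h1 := hp.hasDerivAt.ofReal_comp
  have h2 : HasDerivAt (fun z : ℂ => Complex.exp (z * Complex.I))
      (Complex.exp (θ * Complex.I) * Complex.I) θ := by
    simpa using ((hasDerivAt_id (θ : ℂ)).mul_const Complex.I).cexp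
  have h3 := ((hasDerivAt_laurentSum N (trigCoeff N a b)
    (Complex.exp_ne_zero (θ * Complex.I))).comp (θ : ℂ) h2).comp_ofReal
  have h4 : (fun φ : ℝ => (trigPoly N a b φ : ℂ)) = fun φ : ℝ =>
      (laurentSum N (trigCoeff N a b) ∘ fun z : ℂ => Complex.exp (z * Complex.I)) (φ : ℂ) :=
    funext fun φ => trigPoly_eq_laurentSum N a b φ
  rw [← h4] at h3
  rw [h1.unique h3]
  have := Complex.exp_ne_zero (θ * Complex.I)
  field_simp

/-- The Laurent coefficients of the first coordinate of the curve. -/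
noncomputable def fstCoeff (N : ℕ) (a b : ℕ → ℝ) (k : ℤ) : ℂ :=
  2⁻¹ * ((1 - (k - 1 : ℤ)) * trigCoeff N a b (k - 1) + (1 + (k + 1 : ℤ)) * trigCoeff N a b (k + 1))

/-- The Laurent coefficients of the second coordinate of the curve. -/
noncomputable def sndCoeff (N : ℕ) (a b : ℕ → ℝ) (k : ℤ) : ℂ :=
  -Complex.I / 2 *
    ((1 - (k - 1 : ℤ)) * trigCoeff N a b (k - 1) - (1 + (k + 1 : ℤ)) * trigCoeff N a b (k + 1))

/-- The Laurent polynomial restricting to `p + p''` on the unit circle. -/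
noncomputable def curvatureSum (N : ℕ) (a b : ℕ → ℝ) (t : ℂ) : ℂ :=
  laurentSum N (fun k => (1 - k ^ 2) * trigCoeff N a b k) t

/-- On the circle the two sums are p + ip' and p - ip', so this is the real part of t(p + ip'). -/
theorem laurentSum_fstCoeff (N : ℕ) (a b : ℕ → ℝ) {t : ℂ} (ht : t ≠ 0) :
    laurentSum (N + 1) (fstCoeff N a b) t =
      2⁻¹ * (t * laurentSum N (fun k => (1 - k) * trigCoeff N a b k) t +
        t⁻¹ * laurentSum N (fun k => (1 + k) * trigCoeff N a b k) t) := by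
  rw [← laurentSum_shift_right (fun k hk => by simp [trigCoeff_eq_zero_of_lt a b hk]) ht,
    ← laurentSum_shift_left (fun k hk => by simp [trigCoeff_eq_zero_of_lt a b hk]) ht,
    ← laurentSum_add, ← laurentSum_const_mul]
  rfl

theorem laurentSum_sndCoeff (N : ℕ) (a b : ℕ → ℝ) {t : ℂ} (ht : t ≠ 0) :
    laurentSum (N + 1) (sndCoeff N a b) t =
      -Complex.I / 2 * (t * laurentSum N (fun k => (1 - k) * trigCoeff N a b k) t -
        t⁻¹ * laurentSum N (fun k => (1 + k) * trigCoeff N a b k) t) := by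
  rw [← laurentSum_shift_right (fun k hk => by simp [trigCoeff_eq_zero_of_lt a b hk]) ht,
    ← laurentSum_shift_left (fun k hk => by simp [trigCoeff_eq_zero_of_lt a b hk]) ht,
    ← laurentSum_sub, ← laurentSum_const_mul]
  rfl

/-- This is dx/dθ = -(p + p'') sin θ divided by dt/dθ = it; up to a factor shared with the second
coordinate, t² - 1 plays the role of -sin θ. -/
theorem hasDerivAt_fst (N : ℕ) (a b : ℕ → ℝ) {t : ℂ} (ht : t ≠ 0) :
    HasDerivAt (laurentSum (N + 1) (fstCoeff N a b))
      ((t ^ 2 - 1) * (2⁻¹ * (t ^ (-2 : ℤ) * curvatureSum N a b t))) t := by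
  refine (hasDerivAt_laurentSum (N + 1) _ ht).congr_deriv ?_
  have h : (fun k : ℤ => k * fstCoeff N a b k) = fun k : ℤ => 2⁻¹ *
      ((1 - ((k - 1 : ℤ) : ℂ) ^ 2) * trigCoeff N a b (k - 1) -
        (1 - ((k + 1 : ℤ) : ℂ) ^ 2) * trigCoeff N a b (k + 1)) := by
    ext k
    rw [fstCoeff]
    push_cast
    ring
  rw [h, laurentSum_const_mul, laurentSum_sub,
    laurentSum_shift_right (c := fun k : ℤ => (1 - (k : ℂ) ^ 2) * trigCoeff N a b k)
      (fun k hk => by simp [trigCoeff_eq_zero_of_lt a b hk]) ht,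
    laurentSum_shift_left (c := fun k : ℤ => (1 - (k : ℂ) ^ 2) * trigCoeff N a b k)
      (fun k hk => by simp [trigCoeff_eq_zero_of_lt a b hk]) ht, curvatureSum, zpow_neg]
  norm_cast
  field_simp

theorem hasDerivAt_snd (N : ℕ) (a b : ℕ → ℝ) {t : ℂ} (ht : t ≠ 0) :
    HasDerivAt (laurentSum (N + 1) (sndCoeff N a b))
      (-Complex.I * (t ^ 2 + 1) * (2⁻¹ * (t ^ (-2 : ℤ) * curvatureSum N a b t))) t := by
  refine (hasDerivAt_laurentSum (N + 1) _ ht).congr_deriv ?_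
  have h : (fun k : ℤ => k * sndCoeff N a b k) = fun k : ℤ => -Complex.I / 2 *
      ((1 - ((k - 1 : ℤ) : ℂ) ^ 2) * trigCoeff N a b (k - 1) +
        (1 - ((k + 1 : ℤ) : ℂ) ^ 2) * trigCoeff N a b (k + 1)) := by
    ext k
    rw [sndCoeff]
    push_cast
    ring
  rw [h, laurentSum_const_mul, laurentSum_add,
    laurentSum_shift_right (c := fun k : ℤ => (1 - (k : ℂ) ^ 2) * trigCoeff N a b k)
      (fun k hk => by simp [trigCoeff_eq_zero_of_lt a b hk]) ht,
    laurentSum_shift_left (c := fun k : ℤ => (1 - (k : ℂ) ^ 2) * trigCoeff N a b k)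
      (fun k hk => by simp [trigCoeff_eq_zero_of_lt a b hk]) ht, curvatureSum, zpow_neg]
  norm_cast
  field_simp

theorem isLaurentParam_supportParam (N : ℕ) (a b : ℕ → ℝ) :
    IsLaurentParam (supportParam (trigPoly N a b)) (laurentSum (N + 1) (fstCoeff N a b))
      (laurentSum (N + 1) (sndCoeff N a b)) := by
  have hP (t : ℂ) : laurentSum N (fun k => (1 - k) * trigCoeff N a b k) t =
      laurentSum N (trigCoeff N a b) t - laurentSum N (fun k => k * trigCoeff N a b k) t := by
    rw [← laurentSum_sub]
    simp only [sub_mul, one_mul]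
  have hQ (t : ℂ) : laurentSum N (fun k => (1 + k) * trigCoeff N a b k) t =
      laurentSum N (trigCoeff N a b) t + laurentSum N (fun k => k * trigCoeff N a b k) t := by
    rw [← laurentSum_add]
    simp only [add_mul, one_mul]
  have hE (θ : ℝ) : Complex.cos θ + Complex.sin θ * Complex.I = Complex.exp (θ * Complex.I) :=
    (Complex.exp_mul_I _).symm
  have hE' (θ : ℝ) : Complex.cos θ - Complex.sin θ * Complex.I = (Complex.exp (θ * Complex.I))⁻¹ := by
    rw [← Complex.exp_neg, ← neg_mul, Complex.exp_mul_I, Complex.cos_neg, Complex.sin_neg]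
    ring
  refine ⟨laurentSum_mem _ _, laurentSum_mem _ _, fun θ => ?_, fun θ => ?_⟩
  · rw [laurentSum_fstCoeff N a b (Complex.exp_ne_zero _), hP, hQ, ← hE', ← hE]
    simp only [supportParam, Matrix.cons_val_zero]
    push_cast
    rw [trigPoly_eq_laurentSum, deriv_trigPoly_eq_laurentSum, ← hE]
    ring
  · rw [laurentSum_sndCoeff N a b (Complex.exp_ne_zero _), hP, hQ, ← hE', ← hE]
    simp only [supportParam, Matrix.cons_val_one]
    push_cast
    rw [trigPoly_eq_laurentSum, deriv_trigPoly_eq_laurentSum, ← hE]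
    linear_combination (Complex.sin θ * laurentSum N (trigCoeff N a b)
      (Complex.cos θ + Complex.sin θ * Complex.I)) * Complex.I_sq

/-! ### Counting parameters on the circle -/

theorem exp_arg_mul_I_of_norm_eq_one {z : ℂ} (hz : ‖z‖ = 1) :
    Complex.exp (z.arg * Complex.I) = z := by
  simpa [hz] using Complex.norm_mul_exp_arg_mul_I z

namespace IsLaurentParam

variable {γ : ℝ → Fin 2 → ℝ} {x y : ℂ → ℂ}

theorem eq_iff (h : IsLaurentParam γ x y) (θ φ : ℝ) :
    γ θ = γ φ ↔ x (Complex.exp (θ * Complex.I)) = x (Complex.exp (φ * Complex.I)) ∧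
      y (Complex.exp (θ * Complex.I)) = y (Complex.exp (φ * Complex.I)) := by
  rw [← h.fst_eq, ← h.fst_eq, ← h.snd_eq, ← h.snd_eq, Complex.ofReal_inj, Complex.ofReal_inj]
  constructor
  · intro e
    simp [e]
  · rintro ⟨e₀, e₁⟩
    ext i
    fin_cases i
    · exact e₀
    · exact e₁

theorem image_Icc_eq_range (h : IsLaurentParam γ x y) :
    γ '' Set.Icc (-Real.pi) Real.pi = Set.range γ := by
  refine (Set.image_subset_range _ _).antisymm ?_
  rintro _ ⟨θ, rfl⟩
  refine ⟨(Complex.exp (θ * Complex.I)).arg, Set.Ioc_subset_Icc_self (Complex.arg_mem_Ioc _), ?_⟩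
  rw [h.eq_iff, exp_arg_mul_I_of_norm_eq_one (Complex.norm_exp_ofReal_mul_I θ)]
  exact ⟨rfl, rfl⟩

/-- If opposite parameters have equal images and, up to finitely many exceptions, no other
parameters do, the curve is traced twice. -/
theorem tracesTimes_two (h : IsLaurentParam γ x y) (hx : ∀ t, x (-t) = x t)
    (hy : ∀ t, y (-t) = y t) {E : Set ℂ} (hE : E.Finite)
    (hinj : ∀ t ≠ 0, t ∉ E → ∀ s ≠ 0, x s = x t → y s = y t → s ^ 2 = t ^ 2) :
    TracesTimes γ 2 := by
  have hfin : {θ ∈ Set.Ioc (-Real.pi) Real.pi | Complex.exp ((θ : ℝ) * Complex.I) ∈ E}.Finite :=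
    Set.Finite.of_finite_image (f := fun θ : ℝ => Complex.exp (θ * Complex.I))
      (hE.subset (by rintro _ ⟨θ, hθ, rfl⟩; exact hθ.2))
      (injOn_exp_mul_I.mono fun θ hθ => hθ.1)
  refine hfin.subset fun θ hθ => ⟨hθ.1, ?_⟩
  by_contra hE'
  refine hθ.2 ?_
  have hexp : Complex.exp ((-Complex.exp (θ * Complex.I)).arg * Complex.I) =
      -Complex.exp (θ * Complex.I) :=
    exp_arg_mul_I_of_norm_eq_one (by rw [norm_neg, Complex.norm_exp_ofReal_mul_I])
  -- Outside E the fibre corresponds to the two antipodal circle points t and -t, each having one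
  -- argument in (-π, π].
  have hset : {s ∈ Set.Ioc (-Real.pi) Real.pi | γ s = γ θ} =
      {θ, (-Complex.exp (θ * Complex.I)).arg} := by
    ext s
    constructor
    · rintro ⟨hs, hsθ⟩
      obtain ⟨h0, h1⟩ := (h.eq_iff s θ).1 hsθ
      have hsq := hinj _ (Complex.exp_ne_zero _) hE' _ (Complex.exp_ne_zero _) h0 h1
      rcases sq_eq_sq_iff_eq_or_eq_neg.1 hsq with h2 | h2
      · exact Or.inl (injOn_exp_mul_I hs hθ.1 h2)
      · exact Or.inr (injOn_exp_mul_I hs (Complex.arg_mem_Ioc _) (h2.trans hexp.symm))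
    · rintro (rfl | rfl)
      · exact ⟨hθ.1, rfl⟩
      · refine ⟨Complex.arg_mem_Ioc _, ?_⟩
        rw [h.eq_iff, hexp, hx, hy]
        exact ⟨rfl, rfl⟩
  rw [hset, Set.ncard_pair]
  intro heq
  rw [← heq] at hexp
  exact Complex.exp_ne_zero _ (self_eq_neg.1 hexp)

end IsLaurentParam

/-! ### The two cases for the support curve -/

section

variable {N : ℕ} {a b : ℕ → ℝ}

theorem supportCurve_trigPoly_eq_range (N : ℕ) (a b : ℕ → ℝ) :
    supportCurve (trigPoly N a b) = Set.range (supportParam (trigPoly N a b)) :=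
  (isLaurentParam_supportParam N a b).image_Icc_eq_range

theorem trigCoeff_top_ne_zero (hN : 2 ≤ N) (hlead : a N ≠ 0 ∨ b N ≠ 0) :
    trigCoeff N a b N ≠ 0 := by
  rw [Ne, trigCoeff_natCast_eq_zero_iff a b (by omega) le_rfl]
  tauto

theorem trigCoeff_bot_ne_zero (hN : 2 ≤ N) (hlead : a N ≠ 0 ∨ b N ≠ 0) :
    trigCoeff N a b (-N) ≠ 0 := by
  rw [Ne, trigCoeff_neg_natCast_eq_zero_iff a b (by omega) le_rfl]
  tauto

/-- The coefficient is (1 - N)/2 times the top coefficient of p; it would vanish for N = 1. -/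
theorem fstCoeff_top_ne_zero (hN : 2 ≤ N) (hlead : a N ≠ 0 ∨ b N ≠ 0) :
    fstCoeff N a b (N + 1 : ℕ) ≠ 0 := by
  have h1 : (1 : ℂ) - N ≠ 0 := by
    rw [sub_ne_zero]
    exact_mod_cast (show 1 ≠ N by omega)
  have h2 : trigCoeff N a b ((N : ℤ) + 1 + 1) = 0 := trigCoeff_eq_zero_of_lt a b (by omega)
  simp [fstCoeff, h1, h2, trigCoeff_top_ne_zero hN hlead]

theorem fstCoeff_bot_ne_zero (hN : 2 ≤ N) (hlead : a N ≠ 0 ∨ b N ≠ 0) :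
    fstCoeff N a b (-(N + 1 : ℕ)) ≠ 0 := by
  have h1 : (1 : ℂ) - N ≠ 0 := by
    rw [sub_ne_zero]
    exact_mod_cast (show 1 ≠ N by omega)
  have h2 : trigCoeff N a b (-((N + 1 : ℕ) : ℤ) - 1) = 0 := trigCoeff_eq_zero_of_lt a b (by omega)
  have h3 : (-((N + 1 : ℕ) : ℤ) + 1) = -N := by omega
  rw [fstCoeff, h2, h3]
  push_cast
  rw [mul_zero, zero_add, ← sub_eq_add_neg]
  exact mul_ne_zero (by norm_num) (mul_ne_zero h1 (trigCoeff_bot_ne_zero hN hlead))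

theorem exists_curvatureSum_ne_zero (hN : 2 ≤ N) (hlead : a N ≠ 0 ∨ b N ≠ 0) :
    ∃ t ≠ 0, curvatureSum N a b t ≠ 0 := by
  by_contra! hcon
  have h1 := coeff_eq_zero_of_laurentSum_eq_zero hcon (k := N) (by simp)
  rcases mul_eq_zero.1 h1 with h2 | h2
  · have h3 : (N : ℂ) ^ 2 = 1 := by
      push_cast at h2
      linear_combination -h2
    have h4 : N ^ 2 = 1 := by exact_mod_cast h3
    nlinarith
  · exact trigCoeff_top_ne_zero hN hlead h2

/-- If the curve were a point, x would be constant and its derivative zero, contradicting its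
nonzero coefficient at the exponent N + 1. -/
theorem nontrivial_range_supportParam (hN : 2 ≤ N) (hlead : a N ≠ 0 ∨ b N ≠ 0) :
    (Set.range (supportParam (trigPoly N a b))).Nontrivial := by
  rw [← Set.not_subsingleton_iff]
  intro hsub
  have h := isLaurentParam_supportParam N a b
  have hconst := laurentFun.eq_zero_of_infinite
    (laurentFun.sub_mem h.fst_mem (laurentFun.algebraMap_mem (supportParam (trigPoly N a b) 0 0 : ℂ)))
    infinite_range_exp_mul_I (by
      rintro _ ⟨θ, rfl⟩ -
      rw [Pi.sub_apply, ← h.fst_eq, hsub ⟨θ, rfl⟩ ⟨0, rfl⟩]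
      simp)
  have hzero : ∀ t ≠ 0, laurentSum (N + 1) (fun k => k * fstCoeff N a b k) t = 0 := by
    intro t ht
    have h1 := hasDerivAt_laurentSum (N + 1) (fstCoeff N a b) ht
    have h2 : HasDerivAt (laurentSum (N + 1) (fstCoeff N a b)) 0 t := by
      refine (hasDerivAt_const t (supportParam (trigPoly N a b) 0 0 : ℂ)).congr_of_eventuallyEq ?_
      filter_upwards [isOpen_ne.mem_nhds ht] with s hs
      exact sub_eq_zero.1 (hconst s hs)
    simpa [ht] using h1.unique h2
  have h3 := coeff_eq_zero_of_laurentSum_eq_zero hzero (k := (N + 1 : ℕ)) (by simp; omega)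
  refine mul_ne_zero ?_ (fstCoeff_top_ne_zero hN hlead) h3
  exact_mod_cast Nat.succ_ne_zero N

theorem exists_isDefiningPolynomial_supportCurve (hN : 2 ≤ N) (hlead : a N ≠ 0 ∨ b N ≠ 0) :
    ∃ f, IsDefiningPolynomial (supportCurve (trigPoly N a b)) f := by
  have h := isLaurentParam_supportParam N a b
  obtain ⟨g, hg0, -, hg⟩ := exists_relation_totalDegree_le (N + 1) (by omega) (fstCoeff N a b)
    (sndCoeff N a b) (fstCoeff_top_ne_zero hN hlead) (fstCoeff_bot_ne_zero hN hlead)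
  obtain ⟨f, hf, hf0, -⟩ := h.exists_mem_vanishingIdeal hg0 hg
  rw [supportCurve_trigPoly_eq_range]
  refine exists_isDefiningPolynomial h.isPrime_vanishingIdeal (fun hbot => hf0 ?_)
    (nontrivial_range_supportParam hN hlead)
  rw [hbot] at hf
  exact hf

theorem exists_finite_sq_eq_supportParam (hN : 2 ≤ N) (hlead : a N ≠ 0 ∨ b N ≠ 0)
    {f : MvPolynomial (Fin 2) ℝ} (hf : IsDefiningPolynomial (supportCurve (trigPoly N a b)) f) :
    ∃ E : Set ℂ, E.Finite ∧ ∀ t ≠ 0, t ∉ E → ∀ s ≠ 0,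
      laurentSum (N + 1) (fstCoeff N a b) s = laurentSum (N + 1) (fstCoeff N a b) t →
      laurentSum (N + 1) (sndCoeff N a b) s = laurentSum (N + 1) (sndCoeff N a b) t →
      s ^ 2 = t ^ 2 := by
  rw [supportCurve_trigPoly_eq_range] at hf
  obtain ⟨t₀, ht₀, hcurv⟩ := exists_curvatureSum_ne_zero hN hlead
  refine (isLaurentParam_supportParam N a b).exists_finite_sq_eq hf
    (r := fun t => 2⁻¹ * (t ^ (-2 : ℤ) * curvatureSum N a b t)) ?_ ht₀ ?_
    (fun t ht => hasDerivAt_fst N a b ht) (fun t ht => hasDerivAt_snd N a b ht)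
  · exact laurentFun.const_mul_mem _ (laurentFun.mul_mem (laurentFun.zpow_mem _)
      (laurentSum_mem N _))
  · exact mul_ne_zero (by norm_num) (mul_ne_zero (zpow_ne_zero _ ht₀) hcurv)

/-- If the curve is invariant under `t ↦ -t`, then `p` has only odd frequencies. -/
theorem trigCoeff_eq_zero_of_neg_eq
    (hx : ∀ t ≠ 0, laurentSum (N + 1) (fstCoeff N a b) (-t) = laurentSum (N + 1) (fstCoeff N a b) t)
    (hy : ∀ t ≠ 0, laurentSum (N + 1) (sndCoeff N a b) (-t) = laurentSum (N + 1) (sndCoeff N a b) t)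
    {k : ℤ} (hk : Even k) : trigCoeff N a b k = 0 := by
  by_cases hkN : N < k.natAbs
  · exact trigCoeff_eq_zero_of_lt a b hkN
  have key (c : ℤ → ℂ) (hc : ∀ t ≠ 0, laurentSum (N + 1) c (-t) = laurentSum (N + 1) c t) :
      c (k + 1) = 0 := by
    have h1 : ∀ t ≠ 0, laurentSum (N + 1) (fun j => (-1) ^ j * c j - c j) t = 0 := by
      intro t ht
      rw [laurentSum_sub, ← laurentSum_neg, hc t ht, sub_self]
    have h2 := coeff_eq_zero_of_laurentSum_eq_zero h1 (k := k + 1) (by simp; omega)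
    rw [hk.add_one.neg_one_zpow] at h2
    linear_combination -h2 / 2
  have h1 := key _ hx
  have h2 := key _ hy
  -- The combination x + iy isolates (1 - k) times the k-th coefficient of p, at the odd exponent k
  -- + 1, where invariance forces zero. Since k is even, 1 - k ≠ 0.
  have h3 : (1 - (k : ℂ)) * trigCoeff N a b k = 0 := by
    simp only [fstCoeff, sndCoeff, add_sub_cancel_right] at h1 h2
    linear_combination h1 + Complex.I * h2 + (1 / 2 * ((1 - (k : ℂ)) * trigCoeff N a b k -
      (1 + ((k + 1 + 1 : ℤ) : ℂ)) * trigCoeff N a b (k + 1 + 1))) * Complex.I_sq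
  refine (mul_eq_zero.1 h3).resolve_left fun h4 => ?_
  have : k = 1 := by exact_mod_cast (sub_eq_zero.1 h4).symm
  rw [this] at hk
  exact absurd hk (by decide)

theorem totalDegree_of_exists_even (hN : 2 ≤ N) (hlead : a N ≠ 0 ∨ b N ≠ 0)
    (heven : a 0 ≠ 0 ∨ ∃ k : ℕ, 1 ≤ k ∧ 2 * k ≤ N ∧ (a (2 * k) ≠ 0 ∨ b (2 * k) ≠ 0))
    {f : MvPolynomial (Fin 2) ℝ} (hf : IsDefiningPolynomial (supportCurve (trigPoly N a b)) f) :
    f.totalDegree = 2 * N + 2 := by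
  have h := isLaurentParam_supportParam N a b
  obtain ⟨E, hE, hinj⟩ := exists_finite_sq_eq_supportParam hN hlead hf
  rw [supportCurve_trigPoly_eq_range] at hf
  have hfin : {t | t ≠ 0 ∧
      laurentSum (N + 1) (fstCoeff N a b) (-t) = laurentSum (N + 1) (fstCoeff N a b) t ∧
      laurentSum (N + 1) (sndCoeff N a b) (-t) = laurentSum (N + 1) (sndCoeff N a b) t}.Finite := by
    by_contra hinf
    have key (c : ℤ → ℂ) (hc : ∀ t ∈ {t | t ≠ 0 ∧
        laurentSum (N + 1) (fstCoeff N a b) (-t) = laurentSum (N + 1) (fstCoeff N a b) t ∧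
        laurentSum (N + 1) (sndCoeff N a b) (-t) = laurentSum (N + 1) (sndCoeff N a b) t},
        laurentSum (N + 1) c (-t) = laurentSum (N + 1) c t) :
        ∀ t ≠ 0, laurentSum (N + 1) c (-t) = laurentSum (N + 1) c t := by
      have h1 := laurentFun.eq_zero_of_infinite
        (laurentSum_mem (N + 1) fun j => (-1) ^ j * c j - c j) hinf fun t ht _ => by
          rw [laurentSum_sub, ← laurentSum_neg, hc t ht, sub_self]
      intro t ht
      have := h1 t ht
      rwa [laurentSum_sub, ← laurentSum_neg, sub_eq_zero] at this
    have hzero (k : ℤ) (hk : Even k) : trigCoeff N a b k = 0 :=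
      trigCoeff_eq_zero_of_neg_eq (key _ fun t ht => ht.2.1) (key _ fun t ht => ht.2.2) hk
    rcases heven with h0 | ⟨k, hk1, hkN, hk⟩
    · have := hzero 0 (by simp)
      rw [trigCoeff_zero] at this
      exact h0 (by exact_mod_cast this)
    · have := hzero (2 * k : ℕ) (by simp)
      rw [trigCoeff_natCast_eq_zero_iff a b (by omega) hkN] at this
      tauto
  -- With the finitely many t for which -t gives the same point also excluded, s² = t² improves to s
  -- = t, so the parameter is t itself (m = 1).
  rw [h.totalDegree_eq hf (n := N + 1) (m := 1) (by omega) one_ne_zero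
    (fstCoeff_top_ne_zero hN hlead) (fstCoeff_bot_ne_zero hN hlead) (d := sndCoeff N a b)
    (by simp) (by simp) (hE.union hfin)]
  · ring
  · intro t ht htE s hs hxs hys
    rw [pow_one, pow_one]
    rcases sq_eq_sq_iff_eq_or_eq_neg.1
      (hinj t ht (fun h => htE (Or.inl h)) s hs hxs hys) with h1 | h1
    · exact h1
    · subst h1
      exact absurd (Or.inr ⟨ht, hxs, hys⟩) htE

theorem tracesTimes_and_totalDegree_of_odd (hN : 2 ≤ N) (hlead : a N ≠ 0 ∨ b N ≠ 0)
    (h0 : a 0 = 0) (hodd : ∀ k : ℕ, 1 ≤ k → 2 * k ≤ N → a (2 * k) = 0 ∧ b (2 * k) = 0)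
    {f : MvPolynomial (Fin 2) ℝ} (hf : IsDefiningPolynomial (supportCurve (trigPoly N a b)) f) :
    TracesTimes (supportParam (trigPoly N a b)) 2 ∧ f.totalDegree = N + 1 := by
  have h := isLaurentParam_supportParam N a b
  obtain ⟨E, hE, hinj⟩ := exists_finite_sq_eq_supportParam hN hlead hf
  rw [supportCurve_trigPoly_eq_range] at hf
  -- N must be odd, because the leading coefficients do not both vanish whereas all even ones do.
  obtain ⟨n, hn⟩ : ∃ n, N + 1 = 2 * n := by
    rcases Nat.even_or_odd' N with ⟨k, rfl | rfl⟩
    · have := hodd k (by omega) le_rfl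
      tauto
    · exact ⟨k + 1, by ring⟩
  have hzero (k : ℤ) (hk : Even k) : trigCoeff N a b k = 0 := by
    by_cases hkN : N < k.natAbs
    · exact trigCoeff_eq_zero_of_lt a b hkN
    obtain ⟨j, rfl⟩ := hk
    rcases Int.natAbs_eq (j + j) with h1 | h1
    · by_cases hj : j = 0
      · subst hj
        simp [trigCoeff_zero, h0]
      rw [h1, trigCoeff_natCast_eq_zero_iff a b (by omega) (by omega)]
      have := hodd j.natAbs (by omega) (by omega)
      rwa [show 2 * j.natAbs = (j + j).natAbs by omega] at this
    · by_cases hj : j = 0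
      · subst hj
        simp [trigCoeff_zero, h0]
      rw [h1, trigCoeff_neg_natCast_eq_zero_iff a b (by omega) (by omega)]
      have := hodd j.natAbs (by omega) (by omega)
      rwa [show 2 * j.natAbs = (j + j).natAbs by omega] at this
  -- Odd frequencies in p are shifted by ±1 to even exponents, so both coordinates are Laurent
  -- polynomials in t².
  have hfst (k : ℤ) (hk : Odd k) : fstCoeff N a b k = 0 := by
    rw [fstCoeff, hzero _ (hk.sub_odd odd_one), hzero _ hk.add_one]
    simp
  have hsnd (k : ℤ) (hk : Odd k) : sndCoeff N a b k = 0 := by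
    rw [sndCoeff, hzero _ (hk.sub_odd odd_one), hzero _ hk.add_one]
    simp
  have hx (t : ℂ) : laurentSum (N + 1) (fstCoeff N a b) t =
      laurentSum n (fun k => fstCoeff N a b (2 * k)) (t ^ 2) := by
    rw [hn, laurentSum_of_odd_eq_zero hfst]
  have hy (t : ℂ) : laurentSum (N + 1) (sndCoeff N a b) t =
      laurentSum n (fun k => sndCoeff N a b (2 * k)) (t ^ 2) := by
    rw [hn, laurentSum_of_odd_eq_zero hsnd]
  refine ⟨h.tracesTimes_two (fun t => by rw [hx, hx, neg_sq]) (fun t => by rw [hy, hy, neg_sq])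
    hE hinj, ?_⟩
  have htop := fstCoeff_top_ne_zero hN hlead
  have hbot := fstCoeff_bot_ne_zero hN hlead
  rw [h.totalDegree_eq hf (n := n) (m := 2) (by omega) two_ne_zero ?_ ?_
    (fun t _ => hx t) (fun t _ => hy t) hE hinj, hn]
  · rw [hn] at htop
    simpa using htop
  · rw [hn] at hbot
    simpa using hbot

end

theorem theorem2p1 (N : ℕ) (hN : 2 ≤ N) (a b : ℕ → ℝ) (hlead : a N ≠ 0 ∨ b N ≠ 0) :
    ((a 0 ≠ 0 ∨ ∃ k : ℕ, 1 ≤ k ∧ 2 * k ≤ N ∧ (a (2 * k) ≠ 0 ∨ b (2 * k) ≠ 0)) →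
      (∃ f, IsDefiningPolynomial (supportCurve (trigPoly N a b)) f) ∧
      ∀ f, IsDefiningPolynomial (supportCurve (trigPoly N a b)) f →
        f.totalDegree = 2 * N + 2) ∧
    ((a 0 = 0 ∧ ∀ k : ℕ, 1 ≤ k → 2 * k ≤ N → a (2 * k) = 0 ∧ b (2 * k) = 0) →
      TracesTimes (supportParam (trigPoly N a b)) 2 ∧
      (∃ f, IsDefiningPolynomial (supportCurve (trigPoly N a b)) f) ∧
      ∀ f, IsDefiningPolynomial (supportCurve (trigPoly N a b)) f →
        f.totalDegree = N + 1) := by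
  have hex := exists_isDefiningPolynomial_supportCurve hN hlead
  refine ⟨fun heven => ⟨hex, fun f hf => totalDegree_of_exists_even hN hlead heven hf⟩, ?_⟩
  rintro ⟨h0, hodd⟩
  obtain ⟨f₀, hf₀⟩ := hex
  exact ⟨(tracesTimes_and_totalDegree_of_odd hN hlead h0 hodd hf₀).1, ⟨f₀, hf₀⟩,
    fun f hf => (tracesTimes_and_totalDegree_of_odd hN hlead h0 hodd hf).2⟩
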